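/- Let $V$ be a finite-dimensional real vector space with a non-degenerate quadratic form $Q$. Let $\mathrm{Cl}(V)$ be its Clifford algebra with the sign convention $v^2=-Q(v)$; write $a\mapsto\hat a$ for the grade involution (induced by $v\mapsto -v$) and $a\mapsto\tilde a$ for the reversal ($v_1\cdots v_k\mapsto v_k\cdots v_1$). Let $$\Gamma(V)=\{a\in \mathrm{Cl}(V)^\times : \sigma_a(x)=a\,x\,\hat a^{-1}\in V\text{ for all }x\in V\}$$ be the Lipschitz group. Equip $V\oplus\mathbb{R}^{1,1}$ (with basis $e_-,e_+$ of $\mathbb{R}^{1,1}$) with the form $\hat Q(v+x_-e_-+x_+e_+)=Q(v)-x_-^2+x_+^2$, and identify $\mathrm{Cl}(V\oplus\mathbb{R}^{1,1})$ with $\mathrm{Mat}(2,\mathrm{Cl}(V))$ by the algebra isomorphism extending $$v+x_-e_-+x_+e_+\;\mapsto\;\begin{pmatrix} v & x_--x_+\\ x_-+x_+ & -v\end{pmatrix}.$$ A Vahlen matrix is an element $A\in\mathrm{Mat}(2,\mathrm{Cl}(V))$ of $\Gamma(V\oplus\mathbb{R}^{1,1})$. Put $e=\begin{pmatrix}1&0\\0&0\end{pmatrix}$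 and $n_\infty=\frac{e_--e_+}{2}=\begin{pmatrix}0&1\\0&0\end{pmatrix}$. Let $W_{\mathrm{pre}}=\{Ae : A \text{ a Vahlen matrix}\}$, whose elements are regarded as columns $(x,y)$ (the first columns of Vahlen matrices), and let the conformal space $W$ be the quotient of $W_{\mathrm{pre}}$ by the relation $(x_1,y_1)\sim(x_2,y_2)$ if and only if $(x_1,y_1)=(x_2r,y_2r)$ for some $r\in\Gamma(V)$. The group of Vahlen matrices acts on $W$ by left multiplication. Let $$N(V)=\{[\xi]\in P(V\oplus\mathbb{R}^{1,1}) : \hat Q(\xi)=0\}$$ be the conformal compactification of $V$, on which a Vahlen matrix $A$ acts by $\sigma_A[\xi]=[A\,\xi\,\hat A^{-1}]$. Theorem. For every Vahlen matrix $A$, the element $(Ae)\,n_\infty\,\widetilde{Ae}=A\,n_\infty\,\tilde A$ is a non-zero $\hat Q$-null vector of $V\oplus\mathbb{R}^{1,1}$, and the point of $N(V)$ it represents depends only on the class of $Ae$ in $W$. The resulting map $$\gamma: W\to N(V),\qquad \gamma([Ae])=[A\,n_\infty\,\tilde A],$$ is well defined and is a bijection. Moreover, $\gamma(AX)=\sigma_A(\gamma(X))$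 for all Vahlen matrices $A$ and all $X\in W$. -/

import Mathlib

open scoped LinearAlgebra.Projectivization

namespace VahlenConformal

noncomputable section

/-! ### Clifford algebra, Lipschitz group, twisted adjoint action -/

section Clifford

variable {V : Type*} [AddCommGroup V] [Module ℝ V]

/-- The Clifford algebra of `(V, Q)` with the sign convention `v * v = - Q v`. -/
abbrev Cl (Q : QuadraticForm ℝ V) : Type _ := CliffordAlgebra (-Q)

/-- The inclusion of `V` in its Clifford algebra. -/
abbrev vec (Q : QuadraticForm ℝ V) : V →ₗ[ℝ] Cl Q := CliffordAlgebra.ι (-Q)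

/-- The grade involution of the Clifford algebra, induced by `v ↦ -v`. -/
abbrev gradeInv {Q : QuadraticForm ℝ V} (a : Cl Q) : Cl Q := CliffordAlgebra.involute a

/-- The reversal of the Clifford algebra, `v₁ ⋯ vₖ ↦ vₖ ⋯ v₁`. -/
abbrev rev {Q : QuadraticForm ℝ V} (a : Cl Q) : Cl Q := CliffordAlgebra.reverse a

/-- The Clifford conjugation: grade involution composed with reversal. -/
abbrev conj {Q : QuadraticForm ℝ V} (a : Cl Q) : Cl Q := gradeInv (rev a)

theorem vec_mul_self (Q : QuadraticForm ℝ V) (v : V) :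
    vec Q v * vec Q v = algebraMap ℝ (Cl Q) (-Q v) :=
  CliffordAlgebra.ι_sq_scalar (-Q) v

theorem vec_injective (Q : QuadraticForm ℝ V) : Function.Injective (vec Q) := by
  intro x y h
  let _ : Invertible (2 : ℝ) := invertibleOfNonzero two_ne_zero
  have h2 := congrArg (CliffordAlgebra.equivExterior (-Q)) h
  simp only [CliffordAlgebra.equivExterior, CliffordAlgebra.changeFormEquiv_apply,
    CliffordAlgebra.changeForm_ι] at h2
  exact ExteriorAlgebra.ι_leftInverse.injective h2

/-- The twisted adjoint action `σ_a(x) = a x â⁻¹` on the Clifford algebra. -/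
def twistedAd {Q : QuadraticForm ℝ V} (a : (Cl Q)ˣ) : Cl Q →ₗ[ℝ] Cl Q :=
  LinearMap.mulLeftRight ℝ ((a : Cl Q), gradeInv ((a⁻¹ : (Cl Q)ˣ) : Cl Q))

theorem twistedAd_apply {Q : QuadraticForm ℝ V} (a : (Cl Q)ˣ) (x : Cl Q) :
    twistedAd a x = a * x * gradeInv ((a⁻¹ : (Cl Q)ˣ) : Cl Q) := rfl

theorem twistedAd_one {Q : QuadraticForm ℝ V} (x : Cl Q) :
    twistedAd (1 : (Cl Q)ˣ) x = x := by
  simp [twistedAd_apply]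

theorem twistedAd_mul {Q : QuadraticForm ℝ V} (a b : (Cl Q)ˣ) (x : Cl Q) :
    twistedAd (a * b) x = twistedAd a (twistedAd b x) := by
  simp [twistedAd_apply, mul_assoc]

theorem twistedAd_inv_apply {Q : QuadraticForm ℝ V} (a : (Cl Q)ˣ) (x : Cl Q) :
    twistedAd a⁻¹ (twistedAd a x) = x := by
  rw [← twistedAd_mul, inv_mul_cancel, twistedAd_one]

/-- For finite-dimensional `V`, a unit that maps `V` into `V` under the twisted adjoint action has
an inverse with the same property. -/
theorem twistedAd_inv_mem [FiniteDimensional ℝ V] {Q : QuadraticForm ℝ V} {a : (Cl Q)ˣ}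
    (ha : ∀ v : V, twistedAd a (vec Q v) ∈ LinearMap.range (vec Q)) (v : V) :
    twistedAd a⁻¹ (vec Q v) ∈ LinearMap.range (vec Q) := by
  have hr : ∀ x ∈ LinearMap.range (vec Q), twistedAd a x ∈ LinearMap.range (vec Q) := by
    rintro _ ⟨w, rfl⟩
    exact ha w
  let T := (twistedAd a).restrict hr
  have hT : Function.Injective T := by
    intro x y h
    have h1 : twistedAd a (x : Cl Q) = twistedAd a (y : Cl Q) := congrArg Subtype.val h
    have h2 := congrArg (twistedAd a⁻¹) h1
    rw [twistedAd_inv_apply, twistedAd_inv_apply] at h2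
    exact Subtype.ext h2
  obtain ⟨y, hy⟩ := (LinearMap.injective_iff_surjective.mp hT) ⟨vec Q v, v, rfl⟩
  have hy' : twistedAd a (y : Cl Q) = vec Q v := congrArg Subtype.val hy
  rw [← hy', twistedAd_inv_apply]
  exact y.2

variable [FiniteDimensional ℝ V]

/-- The Lipschitz group `Γ(V)`: the invertible elements `a` of the Clifford algebra such that
`a x â⁻¹ ∈ V` for all `x ∈ V`. -/
def Lipschitz (Q : QuadraticForm ℝ V) : Subgroup (Cl Q)ˣ where
  carrier := {a | ∀ v : V, twistedAd a (vec Q v) ∈ LinearMap.range (vec Q)}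
  one_mem' := fun v => by rw [twistedAd_one]; exact ⟨v, rfl⟩
  mul_mem' := by
    intro a b ha hb v
    obtain ⟨w, hw⟩ := hb v
    rw [twistedAd_mul, ← hw]
    exact ha w
  inv_mem' := fun ha v => twistedAd_inv_mem ha v

/-- The orthogonal transformation `σ_a` of `V`, for `a ∈ Γ(V)`, as a linear map. -/
def sigmaLin {Q : QuadraticForm ℝ V} (a : Lipschitz Q) : V →ₗ[ℝ] V :=
  (LinearEquiv.ofInjective (vec Q) (vec_injective Q)).symm.toLinearMap ∘ₗ
    ((twistedAd (a : (Cl Q)ˣ)) ∘ₗ vec Q).codRestrict (LinearMap.range (vec Q)) a.2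

theorem vec_sigmaLin {Q : QuadraticForm ℝ V} (a : Lipschitz Q) (v : V) :
    vec Q (sigmaLin a v) = twistedAd (a : (Cl Q)ˣ) (vec Q v) := by
  have h := LinearEquiv.apply_symm_apply (LinearEquiv.ofInjective (vec Q) (vec_injective Q))
    ⟨twistedAd (a : (Cl Q)ˣ) (vec Q v), a.2 v⟩
  exact congrArg Subtype.val h

theorem sigmaLin_inv_apply {Q : QuadraticForm ℝ V} (a : Lipschitz Q) (v : V) :
    sigmaLin a⁻¹ (sigmaLin a v) = v := by
  apply vec_injective Q
  rw [vec_sigmaLin, vec_sigmaLin]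
  exact twistedAd_inv_apply _ _

theorem form_sigmaLin {Q : QuadraticForm ℝ V} (a : Lipschitz Q) (v : V) :
    Q (sigmaLin a v) = Q v := by
  set u : (Cl Q)ˣ := (a : (Cl Q)ˣ) with hu
  set x := vec Q v with hx
  have hy := vec_sigmaLin a v
  have hy2 : vec Q (sigmaLin a v) = gradeInv (u : Cl Q) * x * ((u⁻¹ : (Cl Q)ˣ) : Cl Q) := by
    have h := congrArg gradeInv hy
    simp only [gradeInv, twistedAd_apply, CliffordAlgebra.involute_ι, map_mul,
      CliffordAlgebra.involute_involute, mul_neg, neg_mul, neg_inj] at h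
    exact h
  have hgi : gradeInv ((u⁻¹ : (Cl Q)ˣ) : Cl Q) * gradeInv (u : Cl Q) = 1 := by
    rw [gradeInv, ← map_mul, Units.inv_mul, map_one]
  have hsq : vec Q (sigmaLin a v) * vec Q (sigmaLin a v) = vec Q v * vec Q v := by
    nth_rewrite 2 [hy2]
    rw [hy, twistedAd_apply]
    calc (u : Cl Q) * x * gradeInv ((u⁻¹ : (Cl Q)ˣ) : Cl Q) *
          (gradeInv (u : Cl Q) * x * ((u⁻¹ : (Cl Q)ˣ) : Cl Q))
        = u * x * (gradeInv ((u⁻¹ : (Cl Q)ˣ) : Cl Q) * gradeInv (u : Cl Q)) * x *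
          ((u⁻¹ : (Cl Q)ˣ) : Cl Q) := by simp only [mul_assoc]
      _ = u * (x * x) * ((u⁻¹ : (Cl Q)ˣ) : Cl Q) := by rw [hgi, mul_one]; simp only [mul_assoc]
      _ = x * x := by
          rw [hx, vec_mul_self, ← Algebra.commutes, mul_assoc, Units.mul_inv, mul_one]
  rw [vec_mul_self, vec_mul_self] at hsq
  let _ : Invertible (2 : ℝ) := invertibleOfNonzero two_ne_zero
  have := (algebraMap ℝ (Cl Q)).injective hsq
  linarith

/-- The orthogonal transformation `σ_a : V → V`, `x ↦ a x â⁻¹`, for `a ∈ Γ(V)`. -/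
def sigma {Q : QuadraticForm ℝ V} (a : Lipschitz Q) : Q.IsometryEquiv Q where
  toLinearEquiv := LinearEquiv.ofLinearMap (sigmaLin a) (sigmaLin a⁻¹)
    (LinearMap.ext fun v => by simpa using sigmaLin_inv_apply a⁻¹ v)
    (LinearMap.ext fun v => sigmaLin_inv_apply a v)
  map_app' := form_sigmaLin a

theorem vec_sigma {Q : QuadraticForm ℝ V} (a : Lipschitz Q) (v : V) :
    vec Q (sigma a v) = (a : (Cl Q)ˣ) * vec Q v * gradeInv (((a : (Cl Q)ˣ)⁻¹ : (Cl Q)ˣ) : Cl Q) :=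
  vec_sigmaLin a v

end Clifford

/-! ### Projective null quadrics -/

section Quadric

variable {E : Type*} [AddCommGroup E] [Module ℝ E]

/-- The quadric `{[ξ] ∈ P(E) ; q ξ = 0}`. -/
def nullQuadric (q : QuadraticForm ℝ E) : Set (ℙ ℝ E) :=
  {p | ∃ (ξ : E) (h : ξ ≠ 0), p = Projectivization.mk ℝ ξ h ∧ q ξ = 0}

theorem mk_mem_nullQuadric (q : QuadraticForm ℝ E) (ξ : E) (h : ξ ≠ 0) :
    Projectivization.mk ℝ ξ h ∈ nullQuadric q ↔ q ξ = 0 := by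
  constructor
  · rintro ⟨η, hη, he, h0⟩
    obtain ⟨c, rfl⟩ := (Projectivization.mk_eq_mk_iff' ℝ _ _ _ _).mp he
    rw [QuadraticMap.map_smul, h0, smul_zero]
  · intro h0
    exact ⟨ξ, h, rfl, h0⟩

/-- The transformation `ψ_T : [ξ] ↦ [T ξ]` of the null quadric given by an orthogonal `T`. -/
def psi {q : QuadraticForm ℝ E} (T : q.IsometryEquiv q) (p : nullQuadric q) : nullQuadric q :=
  ⟨Projectivization.map T.toLinearEquiv.toLinearMap T.toLinearEquiv.injective p.1, by
    obtain ⟨_, ξ, hξ, rfl, h0⟩ := p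
    rw [Projectivization.map_mk, mk_mem_nullQuadric]
    exact (T.map_app ξ).trans h0⟩

end Quadric

/-! ### The identification of `Cl(V ⊕ ℝ^{1,1})` with `Mat(2, Cl(V))` -/

section Periodicity

variable {V : Type*} [AddCommGroup V] [Module ℝ V]

/-- The form `v + x₋ e₋ + x₊ e₊ ↦ Q v - x₋² + x₊²` on `V ⊕ ℝ^{1,1}`; a vector is written as
`(v, x₋, x₊)`. -/
def Qhat (Q : QuadraticForm ℝ V) : QuadraticForm ℝ (V × ℝ × ℝ) :=
  Q.prod ((-QuadraticMap.sq).prod QuadraticMap.sq)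

theorem Qhat_apply (Q : QuadraticForm ℝ V) (x : V × ℝ × ℝ) :
    Qhat Q x = Q x.1 - x.2.1 ^ 2 + x.2.2 ^ 2 := by
  simp [Qhat, QuadraticMap.sq]
  ring

/-- `2 × 2` matrices over the Clifford algebra of `V`. -/
abbrev Mat2 (Q : QuadraticForm ℝ V) : Type _ := Matrix (Fin 2) (Fin 2) (Cl Q)

/-- The Clifford map `j : V ⊕ ℝ^{1,1} → Mat(2, Cl(V))`. -/
def j (Q : QuadraticForm ℝ V) : (V × ℝ × ℝ) →ₗ[ℝ] Mat2 Q where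
  toFun x := !![vec Q x.1, algebraMap ℝ (Cl Q) (x.2.1 - x.2.2);
    algebraMap ℝ (Cl Q) (x.2.1 + x.2.2), -vec Q x.1]
  map_add' x y := by
    ext i k
    fin_cases i <;> fin_cases k <;> simp <;> abel
  map_smul' c x := by
    ext i k
    fin_cases i <;> fin_cases k <;>
      simp [Algebra.algebraMap_eq_smul_one, smul_sub, smul_add, mul_smul, sub_smul, add_smul]

theorem j_apply (Q : QuadraticForm ℝ V) (x : V × ℝ × ℝ) :
    j Q x = !![vec Q x.1, algebraMap ℝ (Cl Q) (x.2.1 - x.2.2);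
      algebraMap ℝ (Cl Q) (x.2.1 + x.2.2), -vec Q x.1] := rfl

theorem j_sq (Q : QuadraticForm ℝ V) (x : V × ℝ × ℝ) :
    j Q x * j Q x = algebraMap ℝ (Mat2 Q) ((-Qhat Q) x) := by
  have h := vec_mul_self Q x.1
  have hc := Algebra.commutes (x.2.1 - x.2.2) (vec Q x.1)
  have hc' := Algebra.commutes (x.2.1 + x.2.2) (vec Q x.1)
  rw [j_apply, neg_apply, Qhat_apply, Matrix.algebraMap_eq_diagonal]
  ext i k
  fin_cases i <;> fin_cases k
  · simp only [Fin.zero_eta, Matrix.mul_apply, Fin.sum_univ_two, Matrix.of_apply,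
      Matrix.cons_val', Matrix.cons_val_zero, Matrix.cons_val_one, Matrix.cons_val_fin_one,
      Matrix.diagonal_apply_eq, Pi.algebraMap_apply]
    rw [h, ← map_mul, ← map_add]
    congr 1
    ring
  · simp [Matrix.mul_apply, Fin.sum_univ_two]
    simpa [sub_eq_zero, ← sub_eq_add_neg] using hc.symm
  · simp [Matrix.mul_apply, Fin.sum_univ_two]
    simpa [sub_eq_zero, ← sub_eq_add_neg] using hc'
  · simp only [Fin.mk_one, Matrix.mul_apply, Fin.sum_univ_two, Matrix.of_apply,
      Matrix.cons_val', Matrix.cons_val_zero, Matrix.cons_val_one, Matrix.cons_val_fin_one,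
      Matrix.diagonal_apply_eq, Pi.algebraMap_apply, neg_mul_neg]
    rw [h, ← map_mul, ← map_add]
    congr 1
    ring

/-- The algebra homomorphism `Cl(V ⊕ ℝ^{1,1}) → Mat(2, Cl(V))` extending `j`. -/
def jHat (Q : QuadraticForm ℝ V) : Cl (Qhat Q) →ₐ[ℝ] Mat2 Q :=
  CliffordAlgebra.lift (-Qhat Q) ⟨j Q, j_sq Q⟩

theorem jHat_vec (Q : QuadraticForm ℝ V) (x : V × ℝ × ℝ) :
    jHat Q (vec (Qhat Q) x) = j Q x :=
  CliffordAlgebra.lift_ι_apply _ _ _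

/-- The inclusion `Cl(V) → Cl(V ⊕ ℝ^{1,1})` induced by `V → V ⊕ ℝ^{1,1}`. -/
def incl (Q : QuadraticForm ℝ V) : Cl Q →ₐ[ℝ] Cl (Qhat Q) :=
  CliffordAlgebra.lift (-Q) ⟨vec (Qhat Q) ∘ₗ LinearMap.inl ℝ V (ℝ × ℝ), fun v => by
    simp only [LinearMap.comp_apply, LinearMap.inl_apply]
    rw [vec_mul_self, Qhat_apply]
    simp⟩

theorem incl_vec (Q : QuadraticForm ℝ V) (v : V) :
    incl Q (vec Q v) = vec (Qhat Q) (v, 0, 0) :=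
  CliffordAlgebra.lift_ι_apply _ _ _

/-- The basis vector `e₋` in `Cl(V ⊕ ℝ^{1,1})`. -/
def eMinus (Q : QuadraticForm ℝ V) : Cl (Qhat Q) := vec (Qhat Q) (0, 1, 0)

/-- The basis vector `e₊` in `Cl(V ⊕ ℝ^{1,1})`. -/
def ePlus (Q : QuadraticForm ℝ V) : Cl (Qhat Q) := vec (Qhat Q) (0, 0, 1)

theorem jHat_eMinus (Q : QuadraticForm ℝ V) : jHat Q (eMinus Q) = !![0, 1; 1, 0] := by
  rw [eMinus, jHat_vec, j_apply]
  simp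

theorem jHat_ePlus (Q : QuadraticForm ℝ V) : jHat Q (ePlus Q) = !![0, -1; 1, 0] := by
  rw [ePlus, jHat_vec, j_apply]
  simp

theorem eMinus_sq (Q : QuadraticForm ℝ V) : eMinus Q * eMinus Q = 1 := by
  rw [eMinus, vec_mul_self, Qhat_apply]
  simp

theorem ePlus_sq (Q : QuadraticForm ℝ V) : ePlus Q * ePlus Q = -1 := by
  rw [ePlus, vec_mul_self, Qhat_apply]
  simp

theorem vec_anticomm (Q : QuadraticForm ℝ V) (x y : V)
    (h : Q (x + y) = Q x + Q y) : vec Q x * vec Q y = -(vec Q y * vec Q x) := by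
  have h1 := vec_mul_self Q (x + y)
  rw [map_add, mul_add, add_mul, add_mul, vec_mul_self, vec_mul_self, h, neg_add, map_add] at h1
  have h2 : vec Q y * vec Q x + vec Q x * vec Q y = 0 := by
    rw [← sub_eq_zero] at h1
    rw [← h1]
    abel
  exact eq_neg_of_add_eq_zero_right h2

theorem ePlus_eMinus (Q : QuadraticForm ℝ V) : ePlus Q * eMinus Q = -(eMinus Q * ePlus Q) := by
  apply vec_anticomm
  simp [Qhat_apply]

theorem eMinus_incl (Q : QuadraticForm ℝ V) (a : Cl Q) :
    eMinus Q * incl Q a = incl Q (gradeInv a) * eMinus Q := by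
  induction a using CliffordAlgebra.left_induction with
  | algebraMap r => simp [gradeInv, (Algebra.commutes r (eMinus Q)).symm]
  | add x y hx hy => simp only [gradeInv, map_add, mul_add, add_mul] at hx hy ⊢; rw [hx, hy]
  | ι_mul x m hx =>
    have h : eMinus Q * incl Q (vec Q m) = -(incl Q (vec Q m) * eMinus Q) := by
      rw [incl_vec]
      exact vec_anticomm _ _ _ (by simp [Qhat_apply]; ring)
    simp only [gradeInv, map_mul, CliffordAlgebra.involute_ι, map_neg] at hx ⊢
    rw [← mul_assoc, h, neg_mul, mul_assoc, hx, neg_mul, neg_mul, mul_assoc]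

theorem ePlus_incl (Q : QuadraticForm ℝ V) (a : Cl Q) :
    ePlus Q * incl Q a = incl Q (gradeInv a) * ePlus Q := by
  induction a using CliffordAlgebra.left_induction with
  | algebraMap r => simp [gradeInv, (Algebra.commutes r (ePlus Q)).symm]
  | add x y hx hy => simp only [gradeInv, map_add, mul_add, add_mul] at hx hy ⊢; rw [hx, hy]
  | ι_mul x m hx =>
    have h : ePlus Q * incl Q (vec Q m) = -(incl Q (vec Q m) * ePlus Q) := by
      rw [incl_vec]
      exact vec_anticomm _ _ _ (by simp [Qhat_apply]; ring)
    simp only [gradeInv, map_mul, CliffordAlgebra.involute_ι, map_neg] at hx ⊢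
    rw [← mul_assoc, h, neg_mul, mul_assoc, hx, neg_mul, neg_mul, mul_assoc]

theorem jHat_incl (Q : QuadraticForm ℝ V) (a : Cl Q) :
    jHat Q (incl Q a) = !![a, 0; 0, gradeInv a] := by
  induction a using CliffordAlgebra.left_induction with
  | algebraMap r =>
    ext i k
    fin_cases i <;> fin_cases k <;> simp [gradeInv, Matrix.algebraMap_matrix_apply]
  | add x y hx hy =>
    simp only [map_add, hx, hy]
    ext i k
    fin_cases i <;> fin_cases k <;> simp [gradeInv]
  | ι_mul x m hx =>
    rw [map_mul, map_mul, hx, incl_vec, jHat_vec, j_apply]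
    ext i k
    fin_cases i <;> fin_cases k <;> simp [gradeInv, Matrix.mul_apply, Fin.sum_univ_two]

/-- The linear inverse of `jHat`. -/
def jInv (Q : QuadraticForm ℝ V) (A : Mat2 Q) : Cl (Qhat Q) :=
  (2⁻¹ : ℝ) • (incl Q (A 0 0) * (1 + eMinus Q * ePlus Q) + incl Q (A 0 1) * (eMinus Q - ePlus Q) +
    incl Q (gradeInv (A 1 0)) * (eMinus Q + ePlus Q) +
    incl Q (gradeInv (A 1 1)) * (1 - eMinus Q * ePlus Q))

theorem jInv_add (Q : QuadraticForm ℝ V) (A B : Mat2 Q) :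
    jInv Q (A + B) = jInv Q A + jInv Q B := by
  simp only [jInv, Matrix.add_apply, gradeInv, map_add, add_mul, smul_add]
  abel

theorem jInv_smul (Q : QuadraticForm ℝ V) (c : ℝ) (A : Mat2 Q) :
    jInv Q (c • A) = c • jInv Q A := by
  simp only [jInv, Matrix.smul_apply, gradeInv, map_smul, smul_mul_assoc, ← smul_add]
  rw [smul_comm]

theorem jInv_one (Q : QuadraticForm ℝ V) : jInv Q 1 = 1 := by
  simp only [jInv, Matrix.one_apply_eq, gradeInv, map_one, one_mul, ne_eq, zero_ne_one, one_ne_zero,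
    not_false_eq_true, Matrix.one_apply_ne, map_zero, zero_mul, add_zero]
  rw [add_add_sub_cancel, ← two_smul ℝ (1 : Cl (Qhat Q)), smul_smul]
  norm_num

theorem jInv_incl_mul (Q : QuadraticForm ℝ V) (v : V) (A : Mat2 Q) :
    vec (Qhat Q) (v, 0, 0) * jInv Q A = jInv Q (j Q (v, 0, 0) * A) := by
  rw [← incl_vec, j_apply]
  simp only [jInv, Matrix.mul_apply, Fin.sum_univ_two]
  simp [gradeInv, mul_add, mul_assoc]

theorem jInv_eMinus_mul (Q : QuadraticForm ℝ V) (A : Mat2 Q) :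
    eMinus Q * jInv Q A = jInv Q (j Q (0, 1, 0) * A) := by
  have h1 : eMinus Q * (1 + eMinus Q * ePlus Q) = eMinus Q + ePlus Q := by
    rw [mul_add, mul_one, ← mul_assoc, eMinus_sq, one_mul]
  have h2 : eMinus Q * (1 - eMinus Q * ePlus Q) = eMinus Q - ePlus Q := by
    rw [mul_sub, mul_one, ← mul_assoc, eMinus_sq, one_mul]
  have h3 : eMinus Q * (eMinus Q - ePlus Q) = 1 - eMinus Q * ePlus Q := by
    rw [mul_sub, eMinus_sq]
  have h4 : eMinus Q * (eMinus Q + ePlus Q) = 1 + eMinus Q * ePlus Q := by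
    rw [mul_add, eMinus_sq]
  rw [j_apply]
  simp only [jInv, Matrix.mul_apply, Fin.sum_univ_two, mul_smul_comm, mul_add, ← mul_assoc,
    eMinus_incl]
  simp only [mul_assoc, ← mul_add, h1, h2, h3, h4]
  simp [gradeInv]
  abel

theorem jInv_ePlus_mul (Q : QuadraticForm ℝ V) (A : Mat2 Q) :
    ePlus Q * jInv Q A = jInv Q (j Q (0, 0, 1) * A) := by
  have h0 : ePlus Q * (eMinus Q * ePlus Q) = eMinus Q := by
    rw [← mul_assoc, ePlus_eMinus, neg_mul, mul_assoc, ePlus_sq, mul_neg, mul_one, neg_neg]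
  have h1 : ePlus Q * (1 + eMinus Q * ePlus Q) = eMinus Q + ePlus Q := by
    rw [mul_add, mul_one, h0, add_comm]
  have h2 : ePlus Q * (1 - eMinus Q * ePlus Q) = -(eMinus Q - ePlus Q) := by
    rw [mul_sub, mul_one, h0, neg_sub]
  have h3 : ePlus Q * (eMinus Q - ePlus Q) = 1 - eMinus Q * ePlus Q := by
    rw [mul_sub, ePlus_sq, ePlus_eMinus]
    abel
  have h4 : ePlus Q * (eMinus Q + ePlus Q) = -(1 + eMinus Q * ePlus Q) := by
    rw [mul_add, ePlus_sq, ePlus_eMinus]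
    abel
  rw [j_apply]
  simp only [jInv, Matrix.mul_apply, Fin.sum_univ_two, mul_smul_comm]
  congr 1
  have k : ∀ a b : Cl (Qhat Q), ∀ c : Cl Q,
      ePlus Q * a = b → ePlus Q * (incl Q c * a) = incl Q (gradeInv c) * b := by
    intro a b c h
    rw [← mul_assoc, ePlus_incl, mul_assoc, h]
  rw [mul_add, mul_add, mul_add, k _ _ _ h1, k _ _ _ h2, k _ _ _ h3, k _ _ _ h4]
  simp [gradeInv, -neg_sub, -neg_add_rev]
  abel

theorem jInv_vec_mul (Q : QuadraticForm ℝ V) (x : V × ℝ × ℝ) (A : Mat2 Q) :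
    vec (Qhat Q) x * jInv Q A = jInv Q (j Q x * A) := by
  obtain ⟨v, s, t⟩ := x
  have hx : (v, s, t) = (v, 0, 0) + s • ((0, 1, 0) : V × ℝ × ℝ) + t • ((0, 0, 1) : V × ℝ × ℝ) := by
    simp
  rw [hx, map_add, map_add, map_add, map_add, map_smul, map_smul, map_smul, map_smul, add_mul,
    add_mul, add_mul, add_mul, jInv_add, jInv_add, smul_mul_assoc, smul_mul_assoc, smul_mul_assoc,
    smul_mul_assoc, jInv_smul, jInv_smul, ← jInv_incl_mul, ← jInv_eMinus_mul, ← jInv_ePlus_mul]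
  rfl

theorem jInv_jHat (Q : QuadraticForm ℝ V) (a : Cl (Qhat Q)) : jInv Q (jHat Q a) = a := by
  induction a using CliffordAlgebra.left_induction with
  | algebraMap r =>
    rw [AlgHom.commutes, Algebra.algebraMap_eq_smul_one, jInv_smul, jInv_one,
      Algebra.algebraMap_eq_smul_one]
  | add x y hx hy => rw [map_add, jInv_add, hx, hy]
  | ι_mul x m hx => rw [map_mul, jHat_vec, ← jInv_vec_mul, hx]

theorem jHat_jInv (Q : QuadraticForm ℝ V) (A : Mat2 Q) : jHat Q (jInv Q A) = A := by
  have h2 : ∀ a : Cl Q, (2⁻¹ : ℝ) • (a + a) = a := fun a => by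
    rw [← two_smul ℝ a, smul_smul]
    norm_num
  have e1 : (1 : Mat2 Q) + !![0, 1; 1, 0] * !![0, -1; 1, 0] = !![1 + 1, 0; 0, 0] := by
    ext i k
    fin_cases i <;> fin_cases k <;> simp
  have e2 : (1 : Mat2 Q) - !![0, 1; 1, 0] * !![0, -1; 1, 0] = !![0, 0; 0, 1 + 1] := by
    ext i k
    fin_cases i <;> fin_cases k <;> simp
  have e3 : (!![0, 1; 1, 0] : Mat2 Q) - !![0, -1; 1, 0] = !![0, 1 + 1; 0, 0] := by
    ext i k
    fin_cases i <;> fin_cases k <;> simp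
  have e4 : (!![0, 1; 1, 0] : Mat2 Q) + !![0, -1; 1, 0] = !![0, 0; 1 + 1, 0] := by
    ext i k
    fin_cases i <;> fin_cases k <;> simp
  simp only [jInv, map_smul, map_add, map_mul, map_sub, map_one, jHat_incl, jHat_eMinus,
    jHat_ePlus, e1, e2, e3, e4]
  ext i k
  fin_cases i <;> fin_cases k <;>
    simp only [Matrix.smul_apply, Matrix.add_apply, Matrix.mul_apply, Fin.sum_univ_two,
      Fin.zero_eta, Fin.mk_one, Matrix.of_apply, Matrix.cons_val', Matrix.cons_val_zero,
      Matrix.cons_val_one, Matrix.cons_val_fin_one, mul_add, mul_one, mul_zero, add_zero,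
      zero_add, gradeInv, CliffordAlgebra.involute_involute, h2]

/-- The algebra isomorphism `Cl(V ⊕ ℝ^{1,1}) ≃ Mat(2, Cl(V))` extending `j`. -/
def periodicity (Q : QuadraticForm ℝ V) : Cl (Qhat Q) ≃ₐ[ℝ] Mat2 Q :=
  AlgEquiv.ofBijective (jHat Q)
    (Function.bijective_iff_has_inverse.mpr ⟨jInv Q, jInv_jHat Q, jHat_jInv Q⟩)

theorem periodicity_vec (Q : QuadraticForm ℝ V) (x : V × ℝ × ℝ) :
    periodicity Q (vec (Qhat Q) x) = j Q x := jHat_vec Q x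

/-- The grade involution of `Cl(V ⊕ ℝ^{1,1})` on matrices. -/
def matGradeInv {Q : QuadraticForm ℝ V} (A : Mat2 Q) : Mat2 Q :=
  periodicity Q (gradeInv ((periodicity Q).symm A))

/-- The reversal of `Cl(V ⊕ ℝ^{1,1})` on matrices. -/
def matRev {Q : QuadraticForm ℝ V} (A : Mat2 Q) : Mat2 Q :=
  periodicity Q (rev ((periodicity Q).symm A))

theorem matGradeInv_eq {Q : QuadraticForm ℝ V} (A : Mat2 Q) :
    matGradeInv A =
      !![gradeInv (A 0 0), -gradeInv (A 0 1); -gradeInv (A 1 0), gradeInv (A 1 1)] := by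
  obtain ⟨a, rfl⟩ := (periodicity Q).surjective A
  rw [matGradeInv, AlgEquiv.symm_apply_apply]
  induction a using CliffordAlgebra.left_induction with
  | algebraMap r =>
    ext i k
    fin_cases i <;> fin_cases k <;>
      simp [gradeInv, Matrix.algebraMap_matrix_apply]
  | add x y hx hy =>
    simp only [gradeInv, map_add] at hx hy ⊢
    rw [hx, hy]
    ext i k
    fin_cases i <;> fin_cases k <;> simp [-neg_add_rev, neg_add]
  | ι_mul x m hx =>
    have h : gradeInv (vec (Qhat Q) m * x) = vec (Qhat Q) (-m) * gradeInv x := by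
      rw [gradeInv, map_mul, CliffordAlgebra.involute_ι, map_neg]
    rw [h, map_mul, map_mul, hx, periodicity_vec, periodicity_vec, map_neg, j_apply]
    generalize periodicity Q x = B
    ext i k
    fin_cases i <;> fin_cases k <;>
      simp only [Matrix.mul_apply, Fin.sum_univ_two, Matrix.neg_apply,
        Fin.zero_eta, Fin.mk_one, Matrix.of_apply, Matrix.cons_val', Matrix.cons_val_zero,
        Matrix.cons_val_one, Matrix.cons_val_fin_one, neg_mul, mul_neg, map_add, map_mul, map_neg,
        CliffordAlgebra.involute_ι, AlgHom.commutes, map_sub] <;> abel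

theorem matRev_eq {Q : QuadraticForm ℝ V} (A : Mat2 Q) :
    matRev A = !![conj (A 1 1), conj (A 0 1); conj (A 1 0), conj (A 0 0)] := by
  obtain ⟨a, rfl⟩ := (periodicity Q).surjective A
  rw [matRev, AlgEquiv.symm_apply_apply]
  induction a using CliffordAlgebra.left_induction with
  | algebraMap r =>
    ext i k
    fin_cases i <;> fin_cases k <;>
      simp [conj, gradeInv, rev, Matrix.algebraMap_matrix_apply]
  | add x y hx hy =>
    simp only [conj, gradeInv, rev, map_add] at hx hy ⊢
    rw [hx, hy]
    ext i k
    fin_cases i <;> fin_cases k <;> simp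
  | ι_mul x m hx =>
    simp only [conj, gradeInv, rev, map_mul, CliffordAlgebra.reverse.map_mul,
      CliffordAlgebra.reverse_ι] at hx ⊢
    rw [hx, periodicity_vec, j_apply]
    ext i k
    fin_cases i <;> fin_cases k <;>
      simp [Matrix.mul_apply, Fin.sum_univ_two] <;> abel

/-- The idempotent `e = (1 + e₋ e₊) / 2`. -/
def idem (Q : QuadraticForm ℝ V) : Mat2 Q := !![1, 0; 0, 0]

/-- The null vector `n_∞ = (e₋ - e₊) / 2`. -/
def nInf (Q : QuadraticForm ℝ V) : Mat2 Q := !![0, 1; 0, 0]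

theorem idem_eq (Q : QuadraticForm ℝ V) :
    idem Q = (2⁻¹ : ℝ) • (1 + j Q (0, 1, 0) * j Q (0, 0, 1)) := by
  rw [idem, j_apply, j_apply]
  have h : (2⁻¹ : ℝ) • ((1 : Cl Q) + 1) = 1 := by
    rw [← two_smul ℝ (1 : Cl Q), smul_smul]
    norm_num
  ext i k
  fin_cases i <;> fin_cases k <;> simp [h]

theorem nInf_eq (Q : QuadraticForm ℝ V) :
    nInf Q = j Q (0, 2⁻¹, -2⁻¹) := by
  rw [nInf, j_apply]
  ext i k
  fin_cases i <;> fin_cases k <;> simp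
  rw [← map_add]
  norm_num

end Periodicity

/-! ### Vahlen matrices and the conformal space -/

section Conformal

variable {V : Type*} [AddCommGroup V] [Module ℝ V] [FiniteDimensional ℝ V]

/-- The group of Vahlen matrices: the invertible matrices over `Cl(V)` that correspond to elements
of the Lipschitz group `Γ(V ⊕ ℝ^{1,1})`. -/
def vahlenGroup (Q : QuadraticForm ℝ V) : Subgroup (Mat2 Q)ˣ :=
  (Lipschitz (Qhat Q)).comap
    (Units.map ((periodicity Q).symm.toAlgHom : Mat2 Q →* Cl (Qhat Q)))

/-- The matrix underlying an element of the group of Vahlen matrices. -/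
def mat {Q : QuadraticForm ℝ V} (A : vahlenGroup Q) : Mat2 Q := ((A : (Mat2 Q)ˣ) : Mat2 Q)

theorem mat_mul {Q : QuadraticForm ℝ V} (A B : vahlenGroup Q) : mat (A * B) = mat A * mat B := rfl

theorem mat_one {Q : QuadraticForm ℝ V} : mat (1 : vahlenGroup Q) = 1 := rfl

/-- The element of `Γ(V ⊕ ℝ^{1,1})` corresponding to a Vahlen matrix. -/
def toLipschitz {Q : QuadraticForm ℝ V} (A : vahlenGroup Q) : Lipschitz (Qhat Q) :=
  ⟨Units.map ((periodicity Q).symm.toAlgHom : Mat2 Q →* Cl (Qhat Q)) A, A.2⟩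

/-- The orthogonal transformation `σ_A` of `V ⊕ ℝ^{1,1}` given by a Vahlen matrix `A`. -/
def vahlenSigma {Q : QuadraticForm ℝ V} (A : vahlenGroup Q) :
    (Qhat Q).IsometryEquiv (Qhat Q) :=
  sigma (toLipschitz A)

theorem j_vahlenSigma {Q : QuadraticForm ℝ V} (A : vahlenGroup Q) (x : V × ℝ × ℝ) :
    j Q (vahlenSigma A x) = mat A * j Q x * matGradeInv (mat A⁻¹) := by
  rw [← periodicity_vec, vahlenSigma, vec_sigma, map_mul, map_mul, periodicity_vec]
  congr 2
  exact (periodicity Q).apply_symm_apply _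

/-- The pre-conformal space `W_pre = {A e}`, with `A` ranging over all Vahlen matrices. -/
def preConformal (Q : QuadraticForm ℝ V) : Set (Mat2 Q) :=
  Set.range fun A : vahlenGroup Q => mat A * idem Q

/-- The element `A e` of the pre-conformal space. -/
def column {Q : QuadraticForm ℝ V} (A : vahlenGroup Q) : preConformal Q :=
  ⟨mat A * idem Q, A, rfl⟩

instance (Q : QuadraticForm ℝ V) : MulAction (vahlenGroup Q) (preConformal Q) where
  smul A X := ⟨mat A * X, by
    obtain ⟨_, B, rfl⟩ := X
    exact ⟨A * B, by simp only [mat_mul, mul_assoc]⟩⟩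
  one_smul X := Subtype.ext (one_mul (X : Mat2 Q))
  mul_smul A B X := Subtype.ext (mul_assoc (mat A) (mat B) (X : Mat2 Q))

theorem coe_smul {Q : QuadraticForm ℝ V} (A : vahlenGroup Q) (X : preConformal Q) :
    ((A • X : preConformal Q) : Mat2 Q) = mat A * (X : Mat2 Q) := rfl

/-- Two elements `(x₁, y₁)` and `(x₂, y₂)` of the pre-conformal space (given by the first columns of
the matrices) are equivalent iff `(x₁, y₁) = (x₂ r, y₂ r)` for some `r ∈ Γ(V)`. -/
instance conformalSetoid (Q : QuadraticForm ℝ V) : Setoid (preConformal Q) where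
  r X Y := ∃ r : Lipschitz Q,
    (X : Mat2 Q) 0 0 = (Y : Mat2 Q) 0 0 * ((r : (Cl Q)ˣ) : Cl Q) ∧
    (X : Mat2 Q) 1 0 = (Y : Mat2 Q) 1 0 * ((r : (Cl Q)ˣ) : Cl Q)
  iseqv := by
    refine ⟨fun X => ⟨1, by simp, by simp⟩, ?_, ?_⟩
    · rintro X Y ⟨r, h0, h1⟩
      exact ⟨r⁻¹, by simp [h0, mul_assoc], by simp [h1, mul_assoc]⟩
    · rintro X Y Z ⟨r, h0, h1⟩ ⟨s, k0, k1⟩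
      exact ⟨s * r, by simp [h0, k0, mul_assoc], by simp [h1, k1, mul_assoc]⟩

/-- The conformal space `W` of `V`. -/
def ConformalSpace (Q : QuadraticForm ℝ V) : Type _ := Quotient (conformalSetoid Q)

/-- The class in `W` of an element of the pre-conformal space. -/
def ConformalSpace.mk {Q : QuadraticForm ℝ V} (X : preConformal Q) : ConformalSpace Q :=
  Quotient.mk (conformalSetoid Q) X

theorem smul_equiv {Q : QuadraticForm ℝ V} (A : vahlenGroup Q) (X Y : preConformal Q)
    (h : X ≈ Y) : A • X ≈ A • Y := by
  obtain ⟨r, h0, h1⟩ := h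
  refine ⟨r, ?_, ?_⟩ <;>
    simp only [coe_smul, Matrix.mul_apply, Fin.sum_univ_two, h0, h1, add_mul, mul_assoc]

/-- The action of the group of Vahlen matrices on `W` by left multiplication. -/
instance (Q : QuadraticForm ℝ V) : MulAction (vahlenGroup Q) (ConformalSpace Q) where
  smul A := Quotient.map (fun X => A • X) (smul_equiv A)
  one_smul X := by
    induction X using Quotient.ind with
    | _ X => exact congrArg ConformalSpace.mk (one_smul (vahlenGroup Q) X)
  mul_smul A B X := by
    induction X using Quotient.ind with
    | _ X => exact congrArg ConformalSpace.mk (mul_smul A B X)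

theorem ConformalSpace.smul_mk {Q : QuadraticForm ℝ V} (A : vahlenGroup Q) (X : preConformal Q) :
    A • ConformalSpace.mk X = ConformalSpace.mk (A • X) := rfl

/-- The map `X ↦ X n_∞ X̃` from the pre-conformal space to matrices. -/
def preGamma {Q : QuadraticForm ℝ V} (X : preConformal Q) : Mat2 Q :=
  (X : Mat2 Q) * nInf Q * matRev (X : Mat2 Q)

end Conformal

end

end VahlenConformal

open VahlenConformal

/-! The point attached to `A e` is `[σ_A n_∞]`, so `γ` is an orbit map for the action of the Vahlen
group on the null quadric. The theorem amounts to comparing `A n_∞ Ã` with `σ_A n_∞ = A n_∞ Â⁻¹`,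
proving transitivity on null lines, and identifying the stabilizer of `[n_∞]`.

Comparison: for `a` in a Lipschitz group of a non-degenerate form, `ã â` twisted-commutes with every
vector. Such elements are killed by all contractions, hence are scalars, by a degree count with the
Euler operator on the exterior algebra. So `ã = c â⁻¹` with `c ≠ 0` (`exists_rev_eq_smul`). Over `V
⊕ ℝ^{1,1}` this makes `A n_∞ Ã` a non-zero multiple of `σ_A n_∞`, thus a non-zero null vector. Over
`V` it makes `r` times its Clifford conjugate a scalar, so replacing the column `(x, y)` by `(x r, y
r)` only rescales `A n_∞ Ã`, and `γ` is well defined.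

Surjectivity: two non-orthogonal null vectors are exchanged by the reflection in their difference;
orthogonal ones are joined through a third null vector (`exists_sigma_nInfVec`).

Injectivity: if `A` and `B` give the same point, `B⁻¹ A` fixes `[n_∞]` and is upper triangular, with
top left entry in `Γ(V)`. That entry relates the first columns of `A` and `B`. Equivariance is
multiplicativity of `σ`. -/

namespace VahlenConformal

open CliffordAlgebra

/-! ### The Euler operator and the degree-zero part of the exterior algebra -/

section Euler

variable {V : Type*} [AddCommGroup V] [Module ℝ V]

/-- The Euler operator `x ↦ ∑ i, e i * (e i)^* ⌋ x` of the exterior algebra. -/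
noncomputable def exteriorEuler {n : Type*} [Fintype n] (b : Module.Basis n ℝ V) :
    ExteriorAlgebra ℝ V →ₗ[ℝ] ExteriorAlgebra ℝ V :=
  ∑ i, LinearMap.mulLeft ℝ (ExteriorAlgebra.ι ℝ (b i)) ∘ₗ
    contractLeft (Q := (0 : QuadraticForm ℝ V)) (b.coord i)

variable {n : Type*} [Fintype n] (b : Module.Basis n ℝ V)

theorem exteriorEuler_apply (x : ExteriorAlgebra ℝ V) :
    exteriorEuler b x = ∑ i, ExteriorAlgebra.ι ℝ (b i) *
      contractLeft (Q := (0 : QuadraticForm ℝ V)) (b.coord i) x := by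
  simp [exteriorEuler]

theorem exteriorEuler_algebraMap (r : ℝ) : exteriorEuler b (algebraMap ℝ _ r) = 0 := by
  rw [exteriorEuler_apply]
  refine Finset.sum_eq_zero fun i _ => ?_
  erw [contractLeft_algebraMap]
  exact mul_zero _

/-- Contraction is an antiderivation; its sign cancels the one from moving `b i` past `v`, and the
coordinates of `v` sum back to `v`. Each factor thus raises the eigenvalue by one. -/
theorem exteriorEuler_ι_mul (v : V) (x : ExteriorAlgebra ℝ V) :
    exteriorEuler b (ExteriorAlgebra.ι ℝ v * x) =
      ExteriorAlgebra.ι ℝ v * x + ExteriorAlgebra.ι ℝ v * exteriorEuler b x := by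
  have key : ∀ i, ExteriorAlgebra.ι ℝ (b i) * contractLeft (Q := (0 : QuadraticForm ℝ V))
      (b.coord i) (ExteriorAlgebra.ι ℝ v * x) =
      ExteriorAlgebra.ι ℝ (b.repr v i • b i) * x + ExteriorAlgebra.ι ℝ v *
        (ExteriorAlgebra.ι ℝ (b i) *
          contractLeft (Q := (0 : QuadraticForm ℝ V)) (b.coord i) x) := by
    intro i
    have h : contractLeft (Q := (0 : QuadraticForm ℝ V)) (b.coord i)
        (ExteriorAlgebra.ι ℝ v * x) = b.repr v i • x - ExteriorAlgebra.ι ℝ v *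
          contractLeft (Q := (0 : QuadraticForm ℝ V)) (b.coord i) x :=
      contractLeft_ι_mul (b.coord i) v x
    have h2 : ExteriorAlgebra.ι ℝ (b i) * ExteriorAlgebra.ι ℝ v =
        -(ExteriorAlgebra.ι ℝ v * ExteriorAlgebra.ι ℝ (b i)) :=
      eq_neg_of_add_eq_zero_left (ExteriorAlgebra.ι_add_mul_swap _ _)
    rw [h, mul_sub, ← mul_assoc, h2, map_smul, mul_smul_comm, smul_mul_assoc, neg_mul,
      sub_neg_eq_add, mul_assoc]
  rw [exteriorEuler_apply, exteriorEuler_apply, Finset.sum_congr rfl fun i _ => key i,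
    Finset.sum_add_distrib, ← Finset.mul_sum, ← Finset.sum_mul, ← map_sum, b.sum_repr]

theorem exteriorEuler_of_mem (k : ℕ) (x : ExteriorAlgebra ℝ V) (hx : x ∈ ⋀[ℝ]^k V) :
    exteriorEuler b x = (k : ℝ) • x := by
  induction hx using Submodule.pow_induction_on_left' with
  | algebraMap r => simp [exteriorEuler_algebraMap]
  | add x y i _ _ hx hy => rw [map_add, hx, hy, smul_add]
  | mem_mul m hm i x _ ih =>
    obtain ⟨v, rfl⟩ := hm
    rw [exteriorEuler_ι_mul, ih, mul_smul_comm]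
    push_cast
    rw [add_smul, one_smul, add_comm]

theorem proj_exteriorEuler (k : ℕ) (x : ExteriorAlgebra ℝ V) :
    GradedRing.proj (fun i : ℕ ↦ ⋀[ℝ]^i V) k (exteriorEuler b x) =
      (k : ℝ) • GradedRing.proj (fun i : ℕ ↦ ⋀[ℝ]^i V) k x := by
  induction x using DirectSum.Decomposition.inductionOn fun i : ℕ => ⋀[ℝ]^i V with
  | zero => simp
  | add x y hx hy => rw [map_add, map_add, map_add, hx, hy, smul_add]
  | @homogeneous i m =>
    rw [exteriorEuler_of_mem b i m m.2, GradedRing.proj_apply, GradedRing.proj_apply,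
      DirectSum.decompose_smul, DirectSum.decompose_coe, DirectSum.smul_apply, Submodule.coe_smul]
    by_cases h : i = k
    · subst h; rfl
    · rw [DirectSum.of_eq_of_ne _ _ _ (Ne.symm h)]
      simp

/-- The component of degree `k` is multiplied by `k`, which is invertible in `ℝ` for `k ≠ 0`, so
only degree zero survives in the kernel. -/
theorem mem_range_algebraMap_of_exteriorEuler_eq_zero (x : ExteriorAlgebra ℝ V)
    (hx : exteriorEuler b x = 0) : ∃ r : ℝ, x = algebraMap ℝ _ r := by
  classical
  have h : ∀ k : ℕ, k ≠ 0 → GradedRing.proj (fun i : ℕ ↦ ⋀[ℝ]^i V) k x = 0 := by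
    intro k hk
    have h := proj_exteriorEuler b k x
    rw [hx, map_zero] at h
    exact (smul_eq_zero.mp h.symm).resolve_left (Nat.cast_ne_zero.mpr hk)
  have h0 : x = GradedRing.proj (fun i : ℕ ↦ ⋀[ℝ]^i V) 0 x := by
    conv_lhs => rw [← DirectSum.sum_support_decompose (fun i : ℕ ↦ ⋀[ℝ]^i V) x]
    refine Finset.sum_eq_single 0 (fun k _ hk => h k hk) fun h0 => ?_
    simpa using h0
  have h1 : x ∈ ⋀[ℝ]^0 V := h0 ▸ SetLike.coe_mem _
  change x ∈ LinearMap.range (ExteriorAlgebra.ι ℝ) ^ 0 at h1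
  rw [pow_zero] at h1
  obtain ⟨r, hr⟩ := Submodule.mem_one.mp h1
  exact ⟨r, hr.symm⟩

end Euler

/-! ### Elements that twisted-commute with all vectors -/

section Centralizer

variable {V : Type*} [AddCommGroup V] [Module ℝ V]

/-- An element of a Clifford algebra killed by all contractions is a scalar. -/
theorem mem_range_algebraMap_of_contractLeft_eq_zero [FiniteDimensional ℝ V]
    (q : QuadraticForm ℝ V) (x : CliffordAlgebra q)
    (hx : ∀ d : Module.Dual ℝ V, contractLeft d x = 0) : ∃ r : ℝ, x = algebraMap ℝ _ r := by
  let _ : Invertible (2 : ℝ) := invertibleOfNonzero two_ne_zero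
  -- The linear isomorphism with the exterior algebra commutes with contractions, so the question
  -- moves to the form zero, where a grading is available.
  have hy : exteriorEuler (Module.finBasis ℝ V) (equivExterior q x) = 0 := by
    rw [exteriorEuler_apply]
    refine Finset.sum_eq_zero fun i _ => ?_
    have h : contractLeft (Q := (0 : QuadraticForm ℝ V)) ((Module.finBasis ℝ V).coord i)
        (equivExterior q x) = 0 := by
      rw [equivExterior, changeFormEquiv_apply, ← changeForm_contractLeft, hx, map_zero]
    rw [h]
    exact mul_zero _
  obtain ⟨r, hr⟩ := mem_range_algebraMap_of_exteriorEuler_eq_zero _ _ hy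
  refine ⟨r, (equivExterior q).injective ?_⟩
  rw [hr, equivExterior, changeFormEquiv_apply]
  exact (changeForm_algebraMap _ r).symm

/-- The twisted commutator with a vector is a contraction. -/
theorem ι_mul_sub_involute_mul_ι (q : QuadraticForm ℝ V) (v : V) (x : CliffordAlgebra q) :
    ι q v * x - involute x * ι q v = contractLeft (QuadraticMap.polarBilin q v) x := by
  induction x using CliffordAlgebra.left_induction with
  | algebraMap r =>
    rw [contractLeft_algebraMap, AlgHom.commutes, Algebra.commutes, sub_self]
  | add x y hx hy => rw [map_add, map_add, ← hx, ← hy, mul_add, add_mul]; abel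
  | ι_mul x m hx =>
    rw [contractLeft_ι_mul, ← hx, map_mul, involute_ι, mul_sub, ← mul_assoc, ← mul_assoc,
      ← mul_assoc, QuadraticMap.polarBilin_apply_apply, Algebra.smul_def,
      ← ι_mul_ι_add_swap, add_mul]
    simp only [neg_mul]
    abel

/-- For a non-degenerate form, elements that twisted-commute with all vectors are scalars. -/
theorem mem_range_algebraMap_of_twisted_commute [FiniteDimensional ℝ V]
    (q : QuadraticForm ℝ V) (hq : ∀ v, (∀ w, QuadraticMap.polar q v w = 0) → v = 0)
    (x : CliffordAlgebra q) (hx : ∀ v, ι q v * x = involute x * ι q v) :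
    ∃ r : ℝ, x = algebraMap ℝ _ r := by
  refine mem_range_algebraMap_of_contractLeft_eq_zero q x fun d => ?_
  -- Non-degeneracy and equality of dimensions make every functional the polar form against some
  -- vector, so every contraction is a twisted commutator.
  have hinj : Function.Injective (QuadraticMap.polarBilin q : V →ₗ[ℝ] Module.Dual ℝ V) := by
    refine (injective_iff_map_eq_zero _).mpr fun v hv => hq v fun w => ?_
    exact LinearMap.congr_fun hv w
  obtain ⟨v, rfl⟩ := (LinearMap.injective_iff_surjective_of_finrank_eq_finrank
    (Subspace.dual_finrank_eq (K := ℝ) (V := V)).symm).mp hinj d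
  rw [← ι_mul_sub_involute_mul_ι, hx, sub_self]

end Centralizer

/-! ### The scalar norm on the Lipschitz group -/

section Norm

variable {V : Type*} [AddCommGroup V] [Module ℝ V] [FiniteDimensional ℝ V]

/-- For a non-degenerate form, `ã` is a non-zero multiple of `â⁻¹` on the Lipschitz group. -/
theorem exists_rev_eq_smul {Q : QuadraticForm ℝ V}
    (hQ : ∀ v, (∀ w, QuadraticMap.polar Q v w = 0) → v = 0) (a : Lipschitz Q) :
    ∃ c : ℝ, c ≠ 0 ∧ rev ((a : (Cl Q)ˣ) : Cl Q) =
      c • gradeInv (((a : (Cl Q)ˣ)⁻¹ : (Cl Q)ˣ) : Cl Q) := by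
  let _ : Invertible (2 : ℝ) := invertibleOfNonzero two_ne_zero
  obtain ⟨u, hu⟩ := a
  change ∃ c : ℝ, c ≠ 0 ∧ reverse (u : Cl Q) = c • involute ((u⁻¹ : (Cl Q)ˣ) : Cl Q)
  have hi : involute ((u⁻¹ : (Cl Q)ˣ) : Cl Q) * involute (u : Cl Q) = 1 := by
    rw [← map_mul, Units.inv_mul, map_one]
  have hi' : involute (u : Cl Q) * involute ((u⁻¹ : (Cl Q)ˣ) : Cl Q) = 1 := by
    rw [← map_mul, Units.mul_inv, map_one]
  have hr : reverse (involute (u : Cl Q)) * reverse (involute ((u⁻¹ : (Cl Q)ˣ) : Cl Q)) = 1 := by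
    rw [← reverse.map_mul, hi, reverse.map_one]
  set y : Cl Q := reverse (u : Cl Q) * involute (u : Cl Q) with hy
  have hyi : involute y = reverse (involute (u : Cl Q)) * u := by
    rw [hy, map_mul, involute_involute, reverse_involute]
  -- The vector `u v û⁻¹` equals its own reversal. Multiplying that equation by the reversal of `û`
  -- on the left and by `û` on the right clears the inverses.
  have hcomm : ∀ v, ι (-Q) v * y = involute y * ι (-Q) v := by
    intro v
    obtain ⟨w, hw⟩ := hu v
    rw [twistedAd_apply] at hw
    have hw' := congrArg (reverse (Q := -Q)) hw
    rw [reverse_ι, hw, reverse.map_mul, reverse.map_mul, reverse_ι] at hw'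
    change (u : Cl Q) * ι (-Q) v * involute ((u⁻¹ : (Cl Q)ˣ) : Cl Q) =
      reverse (involute ((u⁻¹ : (Cl Q)ˣ) : Cl Q)) * (ι (-Q) v * reverse (u : Cl Q)) at hw'
    have h2 := congrArg (fun z => reverse (involute (u : Cl Q)) * z * involute (u : Cl Q)) hw'
    calc ι (-Q) v * y = reverse (involute (u : Cl Q)) *
          (reverse (involute ((u⁻¹ : (Cl Q)ˣ) : Cl Q)) * (ι (-Q) v * reverse (u : Cl Q))) *
            involute (u : Cl Q) := by
          rw [← mul_assoc (reverse (involute (u : Cl Q))), hr, one_mul, hy, mul_assoc]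
      _ = involute y * ι (-Q) v * (involute ((u⁻¹ : (Cl Q)ˣ) : Cl Q) * involute (u : Cl Q)) := by
          rw [← h2, hyi]
          simp only [mul_assoc]
      _ = _ := by rw [hi, mul_one]
  have hq : ∀ v, (∀ w, QuadraticMap.polar (-Q) v w = 0) → v = 0 := by
    intro v hv
    refine hQ v fun w => ?_
    have := hv w
    rw [FunLike.coe_neg, QuadraticMap.polar_neg, neg_eq_zero] at this
    exact this
  obtain ⟨c, hc⟩ := mem_range_algebraMap_of_twisted_commute (-Q) hq y hcomm
  have hru : reverse (u : Cl Q) = c • involute ((u⁻¹ : (Cl Q)ˣ) : Cl Q) := by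
    rw [Algebra.smul_def, ← hc, hy, mul_assoc, hi', mul_one]
  refine ⟨c, ?_, hru⟩
  rintro rfl
  rw [zero_smul] at hru
  have h0 : (u : Cl Q) = 0 := by rw [← reverse_reverse (u : Cl Q), hru, map_zero]
  exact u.ne_zero h0

end Norm

end VahlenConformal

namespace VahlenConformal

/-! ### Reflections in the Lipschitz group -/

section Reflection

variable {E : Type*} [AddCommGroup E] [Module ℝ E]

/-- A non-isotropic vector as a unit of the Clifford algebra. -/
noncomputable def vecUnit (q : QuadraticForm ℝ E) (x : E) (hx : q x ≠ 0) : (Cl q)ˣ where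
  val := vec q x
  inv := (-q x)⁻¹ • vec q x
  val_inv := by
    rw [mul_smul_comm, vec_mul_self, Algebra.algebraMap_eq_smul_one, smul_smul,
      inv_mul_cancel₀ (neg_ne_zero.mpr hx), one_smul]
  inv_val := by
    rw [smul_mul_assoc, vec_mul_self, Algebra.algebraMap_eq_smul_one, smul_smul,
      inv_mul_cancel₀ (neg_ne_zero.mpr hx), one_smul]

/-- Non-isotropic vectors act as reflections. -/
theorem twistedAd_vecUnit (q : QuadraticForm ℝ E) (x : E) (hx : q x ≠ 0) (v : E) :
    twistedAd (vecUnit q x hx) (vec q v) =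
      vec q (v - ((q x)⁻¹ * QuadraticMap.polar q x v) • x) := by
  have h1 : vec q x * vec q v =
      algebraMap ℝ (Cl q) (-QuadraticMap.polar q x v) - vec q v * vec q x := by
    rw [eq_sub_iff_add_eq, CliffordAlgebra.ι_mul_ι_add_swap, FunLike.coe_neg,
      QuadraticMap.polar_neg]
  have h2 : gradeInv (((vecUnit q x hx)⁻¹ : (Cl q)ˣ) : Cl q) = (q x)⁻¹ • vec q x := by
    change CliffordAlgebra.involute ((-q x)⁻¹ • vec q x) = _
    rw [map_smul, CliffordAlgebra.involute_ι, inv_neg, neg_smul, smul_neg, neg_neg]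
  rw [twistedAd_apply, h2]
  change vec q x * vec q v * _ = _
  rw [mul_smul_comm, h1, sub_mul, mul_assoc, vec_mul_self, ← Algebra.commutes (-q x),
    ← Algebra.smul_def, ← Algebra.smul_def, neg_smul, neg_smul, map_sub, map_smul, smul_sub,
    smul_neg, smul_neg, smul_smul, smul_smul, inv_mul_cancel₀ hx, one_smul]
  abel

variable [FiniteDimensional ℝ E]

/-- Two non-orthogonal null vectors are exchanged by a reflection. -/
theorem exists_sigma_eq_of_polar_ne_zero {q : QuadraticForm ℝ E} {ξ η : E} (hξ : q ξ = 0)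
    (hη : q η = 0) (h : QuadraticMap.polar q ξ η ≠ 0) : ∃ a : Lipschitz q, sigma a η = ξ := by
  -- For null `ξ` and `η`, non-orthogonality says exactly that `ξ - η` is non-isotropic, so it
  -- defines a reflection.
  have hx : q (ξ - η) = -QuadraticMap.polar q ξ η := by
    rw [sub_eq_add_neg, QuadraticMap.map_add q, QuadraticMap.map_neg, hξ, hη,
      QuadraticMap.polar_neg_right]
    ring
  have hx0 : q (ξ - η) ≠ 0 := by rw [hx]; exact neg_ne_zero.mpr h
  refine ⟨⟨vecUnit q (ξ - η) hx0, fun v => ⟨_, (twistedAd_vecUnit q _ hx0 v).symm⟩⟩, ?_⟩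
  apply vec_injective q
  have hp : QuadraticMap.polar q (ξ - η) η = QuadraticMap.polar q ξ η := by
    rw [QuadraticMap.polar_sub_left, QuadraticMap.polar_self, hη]
    simp
  refine (vec_sigmaLin _ η).trans ((twistedAd_vecUnit q _ hx0 η).trans ?_)
  rw [hp, hx, inv_neg, neg_mul, inv_mul_cancel₀ h, neg_one_smul]
  congr 1
  abel

theorem sigma_mul {q : QuadraticForm ℝ E} (a b : Lipschitz q) (v : E) :
    sigma (a * b) v = sigma a (sigma b v) := by
  apply vec_injective q
  change vec q (sigmaLin (a * b) v) = vec q (sigmaLin a (sigmaLin b v))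
  rw [vec_sigmaLin, vec_sigmaLin, vec_sigmaLin]
  exact twistedAd_mul _ _ _

end Reflection

/-! ### Null vectors of `V ⊕ ℝ^{1,1}` and the orbit of `n_∞` -/

section Hat

/-- The vector `n_∞` of `V ⊕ ℝ^{1,1}`. -/
noncomputable def nInfVec (V : Type*) [AddCommGroup V] : V × ℝ × ℝ := (0, 2⁻¹, -2⁻¹)

theorem nInfVec_ne_zero {V : Type*} [AddCommGroup V] : nInfVec V ≠ 0 := by
  intro h
  have := congrArg (fun x : V × ℝ × ℝ => x.2.1) h
  norm_num [nInfVec] at this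

variable {V : Type*} [AddCommGroup V] [Module ℝ V]

theorem polar_Qhat (Q : QuadraticForm ℝ V) (x y : V × ℝ × ℝ) :
    QuadraticMap.polar (Qhat Q) x y =
      QuadraticMap.polar Q x.1 y.1 - 2 * (x.2.1 * y.2.1) + 2 * (x.2.2 * y.2.2) := by
  simp only [QuadraticMap.polar, Qhat_apply, Prod.fst_add, Prod.snd_add]
  ring

theorem Qhat_nondegenerate {Q : QuadraticForm ℝ V}
    (hQ : ∀ v, (∀ w, QuadraticMap.polar Q v w = 0) → v = 0) (x : V × ℝ × ℝ)
    (hx : ∀ y, QuadraticMap.polar (Qhat Q) x y = 0) : x = 0 := by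
  have h1 : x.1 = 0 := hQ _ fun w => by simpa [polar_Qhat] using hx (w, 0, 0)
  have h2 : x.2.1 = 0 := by simpa [polar_Qhat] using hx (0, 1, 0)
  have h3 : x.2.2 = 0 := by simpa [polar_Qhat] using hx (0, 0, 1)
  exact Prod.ext h1 (Prod.ext h2 h3)

theorem polar_eq_zero_of_associated_nondegenerate {Q : QuadraticForm ℝ V}
    (hQ : (QuadraticMap.associated (R := ℝ) Q).Nondegenerate) (v : V)
    (hv : ∀ w, QuadraticMap.polar Q v w = 0) : v = 0 := by
  refine hQ.1 v fun w => ?_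
  have h := QuadraticMap.two_nsmul_associated ℝ Q
  have h2 := LinearMap.congr_fun (LinearMap.congr_fun h v) w
  rw [QuadraticMap.polarBilin_apply_apply, hv w, LinearMap.smul_apply, LinearMap.smul_apply,
    two_nsmul] at h2
  linarith

theorem j_injective (Q : QuadraticForm ℝ V) : Function.Injective (j Q) := by
  intro x y h
  rw [← periodicity_vec, ← periodicity_vec] at h
  exact vec_injective _ ((periodicity Q).injective h)

theorem j_nInfVec (Q : QuadraticForm ℝ V) : j Q (nInfVec V) = nInf Q := (nInf_eq Q).symm

theorem Qhat_nInfVec (Q : QuadraticForm ℝ V) : Qhat Q (nInfVec V) = 0 := by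
  rw [Qhat_apply]
  simp [nInfVec]

theorem matGradeInv_mul {Q : QuadraticForm ℝ V} (A B : Mat2 Q) :
    matGradeInv (A * B) = matGradeInv A * matGradeInv B := by
  simp [matGradeInv, gradeInv]

/-- Only the first column of `X` enters, which is why `A n_∞ Ã` can be read off from `A e`. -/
theorem mul_nInf_mul_matRev {Q : QuadraticForm ℝ V} (X : Mat2 Q) :
    X * nInf Q * matRev X = !![X 0 0 * conj (X 1 0), X 0 0 * conj (X 0 0);
      X 1 0 * conj (X 1 0), X 1 0 * conj (X 0 0)] := by
  rw [matRev_eq, nInf]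
  ext i k
  fin_cases i <;> fin_cases k <;> simp [Matrix.mul_apply, Fin.sum_univ_two]

theorem mul_idem_apply_zero {Q : QuadraticForm ℝ V} (X : Mat2 Q) (i : Fin 2) : (X * idem Q) i 0 = X i 0 := by
  simp [idem, Matrix.mul_apply, Fin.sum_univ_two]

variable [FiniteDimensional ℝ V]

/-- Every non-zero null vector of `V ⊕ ℝ^{1,1}` is the image of `n_∞` under the Lipschitz group. -/
theorem exists_sigma_nInfVec {Q : QuadraticForm ℝ V}
    (hQ : ∀ v, (∀ w, QuadraticMap.polar Q v w = 0) → v = 0) (ξ : V × ℝ × ℝ) (hξ : ξ ≠ 0)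
    (h0 : Qhat Q ξ = 0) : ∃ a : Lipschitz (Qhat Q), sigma a (nInfVec V) = ξ := by
  by_cases hn : QuadraticMap.polar (Qhat Q) ξ (nInfVec V) = 0
  -- When `ξ` is orthogonal to `n_∞`, for instance proportional to it, one reflection is not enough:
  -- a null `ζ` orthogonal to neither serves as an intermediate stop.
  · obtain ⟨ζ, hζ, h1, h2⟩ : ∃ ζ : V × ℝ × ℝ, Qhat Q ζ = 0 ∧
        QuadraticMap.polar (Qhat Q) ξ ζ ≠ 0 ∧
        QuadraticMap.polar (Qhat Q) ζ (nInfVec V) ≠ 0 := by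
      have key : ∀ u : V, QuadraticMap.polar Q ξ.1 u ≠ ξ.2.1 - ξ.2.2 →
          ∃ ζ : V × ℝ × ℝ, Qhat Q ζ = 0 ∧ QuadraticMap.polar (Qhat Q) ξ ζ ≠ 0 ∧
            QuadraticMap.polar (Qhat Q) ζ (nInfVec V) ≠ 0 := by
        intro u hu
        -- The standard lift of the point `u` to the null cone, whose polar value with `n_∞` is
        -- always `-1`. Since `hn` says that the last two coordinates of `ξ` sum to zero, the terms
        -- in `Q u` drop out of its polar value with `ξ`.
        refine ⟨(u, (1 + Q u) / 2, (1 - Q u) / 2), ?_, ?_, ?_⟩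
        · rw [Qhat_apply]
          ring
        · rw [polar_Qhat] at hn ⊢
          simp [nInfVec] at hn
          intro h
          apply hu
          simp only at h
          linear_combination h - Q u * hn
        · rw [polar_Qhat]
          simp [nInfVec]
          ring_nf
          norm_num
      -- If the difference vanishes, so do both coordinates, since their sum is zero as well. Then
      -- `ξ.1 ≠ 0` and non-degeneracy supplies `u`; otherwise `u = 0` works.
      by_cases ha : ξ.2.1 - ξ.2.2 = 0
      · rw [polar_Qhat] at hn
        simp [nInfVec] at hn
        have hv : ξ.1 ≠ 0 := fun hv =>
          hξ (Prod.ext hv (Prod.ext (by simp; linarith) (by simp; linarith)))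
        have : ∃ w, QuadraticMap.polar Q ξ.1 w ≠ 0 := by
          by_contra! h
          exact hv (hQ _ h)
        obtain ⟨w, hw⟩ := this
        exact key w (by rwa [ha])
      · exact key 0 (by simpa using Ne.symm ha)
    obtain ⟨a, ha⟩ := exists_sigma_eq_of_polar_ne_zero h0 hζ h1
    obtain ⟨b, hb⟩ := exists_sigma_eq_of_polar_ne_zero hζ (Qhat_nInfVec Q) h2
    exact ⟨a * b, by rw [sigma_mul, hb, ha]⟩
  · exact exists_sigma_eq_of_polar_ne_zero h0 (Qhat_nInfVec Q) hn

end Hat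

/-! ### Orbit and stabilizer of `[n_∞]` under Vahlen matrices -/

section Vahlen

variable {V : Type*} [AddCommGroup V] [Module ℝ V] [FiniteDimensional ℝ V] {Q : QuadraticForm ℝ V}

theorem vahlenSigma_mul (A B : vahlenGroup Q) (x : V × ℝ × ℝ) :
    vahlenSigma (A * B) x = vahlenSigma A (vahlenSigma B x) := by
  have h : toLipschitz (A * B) = toLipschitz A * toLipschitz B := Subtype.ext (map_mul _ _ _)
  rw [vahlenSigma, h]
  exact sigma_mul _ _ x

theorem vahlenSigma_ne_zero (A : vahlenGroup Q) {x : V × ℝ × ℝ} (hx : x ≠ 0) :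
    vahlenSigma A x ≠ 0 := fun h =>
  hx ((vahlenSigma A).toLinearEquiv.injective (h.trans (map_zero _).symm))

theorem exists_toLipschitz_eq (a : Lipschitz (Qhat Q)) :
    ∃ A : vahlenGroup Q, toLipschitz A = a := by
  have h : Units.map ((periodicity Q).symm.toAlgHom : Mat2 Q →* Cl (Qhat Q))
      (Units.map ((periodicity Q).toAlgHom : Cl (Qhat Q) →* Mat2 Q) a) = a :=
    Units.ext ((periodicity Q).symm_apply_apply _)
  exact ⟨⟨Units.map ((periodicity Q).toAlgHom : Cl (Qhat Q) →* Mat2 Q) a, by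
    rw [vahlenGroup, Subgroup.mem_comap, h]; exact a.2⟩, Subtype.ext h⟩

theorem mat_mul_inv (A : vahlenGroup Q) : mat A * mat A⁻¹ = 1 := by
  rw [← mat_mul, mul_inv_cancel, mat_one]

theorem mat_inv_mul (A : vahlenGroup Q) : mat A⁻¹ * mat A = 1 := by
  rw [← mat_mul, inv_mul_cancel, mat_one]

/-- `Ã` is a non-zero multiple of `Â⁻¹` for Vahlen matrices. -/
theorem exists_matRev_eq_smul (hQ : ∀ v, (∀ w, QuadraticMap.polar Q v w = 0) → v = 0)
    (A : vahlenGroup Q) : ∃ c : ℝ, c ≠ 0 ∧ matRev (mat A) = c • matGradeInv (mat A⁻¹) := by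
  obtain ⟨c, hc, h⟩ := exists_rev_eq_smul (Qhat_nondegenerate hQ) (toLipschitz A)
  refine ⟨c, hc, ?_⟩
  have h2 := congrArg (periodicity Q) h
  rw [map_smul] at h2
  exact h2

/-- `A n_∞ Ã` is a non-zero multiple of `σ_A n_∞`. -/
theorem exists_mat_mul_nInf_mul_matRev
    (hQ : ∀ v, (∀ w, QuadraticMap.polar Q v w = 0) → v = 0) (A : vahlenGroup Q) :
    ∃ c : ℝ, c ≠ 0 ∧ mat A * nInf Q * matRev (mat A) =
      j Q (c • vahlenSigma A (nInfVec V)) := by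
  obtain ⟨c, hc, h⟩ := exists_matRev_eq_smul hQ A
  refine ⟨c, hc, ?_⟩
  rw [h, map_smul, j_vahlenSigma, j_nInfVec, mul_smul_comm]

theorem preGamma_column (A : vahlenGroup Q) :
    preGamma (column A) = mat A * nInf Q * matRev (mat A) := by
  rw [preGamma, mul_nInf_mul_matRev, mul_nInf_mul_matRev]
  simp only [column, mul_idem_apply_zero]

theorem column_equiv_iff (A B : vahlenGroup Q) :
    (column A ≈ column B) ↔ ∃ r : Lipschitz Q, mat A 0 0 = mat B 0 0 * ((r : (Cl Q)ˣ) : Cl Q) ∧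
      mat A 1 0 = mat B 1 0 * ((r : (Cl Q)ˣ) : Cl Q) := by
  change (∃ r : Lipschitz Q, (mat A * idem Q) 0 0 = (mat B * idem Q) 0 0 * _ ∧
    (mat A * idem Q) 1 0 = (mat B * idem Q) 1 0 * _) ↔ _
  simp only [mul_idem_apply_zero]

/-- The point `[σ_A n_∞]` of the null quadric. -/
noncomputable def nullPoint (A : vahlenGroup Q) : nullQuadric (Qhat Q) :=
  ⟨Projectivization.mk ℝ (vahlenSigma A (nInfVec V)) (vahlenSigma_ne_zero A nInfVec_ne_zero), by
    rw [mk_mem_nullQuadric]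
    exact ((vahlenSigma A).map_app _).trans (Qhat_nInfVec Q)⟩

theorem nullPoint_mul (A B : vahlenGroup Q) :
    nullPoint (A * B) = psi (vahlenSigma A) (nullPoint B) := by
  apply Subtype.ext
  simp only [nullPoint, psi, vahlenSigma_mul, Projectivization.map_mk]
  rfl

theorem nullPoint_eq_iff (A B : vahlenGroup Q) : nullPoint A = nullPoint B ↔
    ∃ c : ℝ, c • vahlenSigma B (nInfVec V) = vahlenSigma A (nInfVec V) := by
  rw [nullPoint, nullPoint, Subtype.mk.injEq, Projectivization.mk_eq_mk_iff']

theorem nullPoint_surjective (hQ : ∀ v, (∀ w, QuadraticMap.polar Q v w = 0) → v = 0)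
    (p : nullQuadric (Qhat Q)) : ∃ A : vahlenGroup Q, nullPoint A = p := by
  obtain ⟨_, ξ, hξ, rfl, h0⟩ := p
  obtain ⟨a, ha⟩ := exists_sigma_nInfVec hQ ξ hξ h0
  obtain ⟨A, rfl⟩ := exists_toLipschitz_eq a
  refine ⟨A, Subtype.ext ?_⟩
  change Projectivization.mk ℝ _ _ = _
  congr 1

/-- Every entry of `A n_∞ Ã` is one column entry times the conjugate of another. Right
multiplication of the column by `r` inserts `r` times its conjugate, a scalar, so all entries are
rescaled together. -/
theorem nullPoint_eq_of_equiv (hQ : ∀ v, (∀ w, QuadraticMap.polar Q v w = 0) → v = 0)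
    (A B : vahlenGroup Q) (h : column A ≈ column B) : nullPoint A = nullPoint B := by
  obtain ⟨r, h0, h1⟩ := (column_equiv_iff A B).mp h
  obtain ⟨c, hc, hr⟩ := exists_rev_eq_smul hQ r
  have hr' : ((r : (Cl Q)ˣ) : Cl Q) * conj ((r : (Cl Q)ˣ) : Cl Q) = algebraMap ℝ _ c := by
    rw [conj, hr, gradeInv, gradeInv, map_smul, CliffordAlgebra.involute_involute, mul_smul_comm,
      Units.mul_inv, Algebra.algebraMap_eq_smul_one]
  have hm : ∀ x y : Cl Q, x * ((r : (Cl Q)ˣ) : Cl Q) * conj (y * ((r : (Cl Q)ˣ) : Cl Q)) =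
      c • (x * conj y) := by
    intro x y
    have : conj (y * ((r : (Cl Q)ˣ) : Cl Q)) = conj ((r : (Cl Q)ˣ) : Cl Q) * conj y := by
      simp [conj, gradeInv, rev]
    rw [this, mul_assoc, ← mul_assoc _ _ (conj y), hr', ← Algebra.smul_def, mul_smul_comm]
  have heq : mat A * nInf Q * matRev (mat A) = c • (mat B * nInf Q * matRev (mat B)) := by
    rw [mul_nInf_mul_matRev, mul_nInf_mul_matRev, h0, h1, hm, hm, hm, hm]
    ext i k
    fin_cases i <;> fin_cases k <;> rfl
  obtain ⟨a, ha, hA⟩ := exists_mat_mul_nInf_mul_matRev hQ A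
  obtain ⟨b, hb, hB⟩ := exists_mat_mul_nInf_mul_matRev hQ B
  rw [hA, hB, ← LinearMap.map_smul (j Q)] at heq
  have h2 := j_injective Q heq
  rw [nullPoint_eq_iff]
  refine ⟨a⁻¹ * (c * b), ?_⟩
  rw [mul_smul, mul_smul, ← h2, smul_smul, inv_mul_cancel₀ ha, one_smul]

/-- A Vahlen matrix that fixes the point `[n_∞]` is upper triangular. -/
theorem mat_one_zero_eq_zero (C : vahlenGroup Q) (c : ℝ)
    (h : vahlenSigma C (nInfVec V) = c • nInfVec V) : mat C 1 0 = 0 := by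
  have h1 := congrArg (j Q) h
  rw [j_vahlenSigma, map_smul, j_nInfVec] at h1
  have h2 := congrArg (fun X => X * matGradeInv (mat C)) h1
  have h3 : matGradeInv (1 : Mat2 Q) = 1 := by simp [matGradeInv, gradeInv]
  rw [mul_assoc, ← matGradeInv_mul, mat_inv_mul, h3, mul_one] at h2
  -- `h2` reads `C n_∞ = c n_∞ Ĉ`. The bottom right entry is `mat C 1 0` on the left, and zero on
  -- the right because `n_∞` has no second row.
  have h4 := congrFun (congrFun h2 1) 1
  simpa [nInf, Matrix.mul_apply, Fin.sum_univ_two] using h4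

/-- For upper triangular `C` and `C⁻¹` the top left entries are mutually inverse, and the top left
entry of `σ_C (v, 0, 0)` is the twisted adjoint action on `v`. That entry is a vector because `C` is
a Vahlen matrix. -/
theorem exists_lipschitz_of_triangular (C : vahlenGroup Q) (h : mat C 1 0 = 0)
    (h' : mat C⁻¹ 1 0 = 0) : ∃ r : Lipschitz Q, ((r : (Cl Q)ˣ) : Cl Q) = mat C 0 0 := by
  have e1 := congrFun (congrFun (mat_mul_inv C) 0) 0
  have e2 := congrFun (congrFun (mat_inv_mul C) 0) 0
  simp only [Matrix.mul_apply, Fin.sum_univ_two, h, h', mul_zero, add_zero,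
    Matrix.one_apply_eq] at e1 e2
  refine ⟨⟨⟨mat C 0 0, mat C⁻¹ 0 0, e1, e2⟩, fun v => ?_⟩, rfl⟩
  refine ⟨(vahlenSigma C (v, 0, 0)).1, ?_⟩
  have h1 := congrFun (congrFun (j_vahlenSigma C (v, 0, 0)) 0) 0
  rw [matGradeInv_eq, h', j_apply, j_apply] at h1
  rw [twistedAd_apply]
  change _ = mat C 0 0 * vec Q v * gradeInv (mat C⁻¹ 0 0)
  simpa [Matrix.mul_apply, Fin.sum_univ_two] using h1

/-- Write `A = B C` with `C = B⁻¹ A` fixing `[n_∞]`. As `C` is upper triangular, the first column of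
`A` is that of `B` times the top left entry of `C`. -/
theorem equiv_of_nullPoint_eq (A B : vahlenGroup Q) (h : nullPoint A = nullPoint B) :
    column A ≈ column B := by
  obtain ⟨c, hc⟩ := (nullPoint_eq_iff A B).mp h
  -- The reversed proportionality shows that `C⁻¹ = A⁻¹ B` is upper triangular too.
  obtain ⟨c', hc'⟩ := (nullPoint_eq_iff B A).mp h.symm
  have key : ∀ (A B : vahlenGroup Q) (c : ℝ),
      c • vahlenSigma B (nInfVec V) = vahlenSigma A (nInfVec V) → mat (B⁻¹ * A) 1 0 = 0 := by
    intro A B c hc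
    apply mat_one_zero_eq_zero _ c
    have h1 : vahlenSigma B⁻¹ (c • vahlenSigma B (nInfVec V)) =
        c • vahlenSigma B⁻¹ (vahlenSigma B (nInfVec V)) := map_smul (vahlenSigma B⁻¹) _ _
    have h2 : vahlenSigma (1 : vahlenGroup Q) (nInfVec V) = nInfVec V :=
      (vahlenSigma (1 : vahlenGroup Q)).toLinearEquiv.injective
        ((vahlenSigma_mul 1 1 _).symm.trans (by rw [mul_one]; rfl))
    rw [vahlenSigma_mul, ← hc, h1, ← vahlenSigma_mul, inv_mul_cancel, h2]
  have h1 := key A B c hc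
  have h2 : mat (B⁻¹ * A)⁻¹ 1 0 = 0 := by
    rw [mul_inv_rev, inv_inv]
    exact key B A c' hc'
  obtain ⟨r, hr⟩ := exists_lipschitz_of_triangular _ h1 h2
  rw [column_equiv_iff]
  have h3 : mat A = mat B * mat (B⁻¹ * A) := by rw [← mat_mul, mul_inv_cancel_left]
  refine ⟨r, ?_, ?_⟩ <;>
    · rw [hr]
      conv_lhs => rw [h3]
      rw [Matrix.mul_apply, Fin.sum_univ_two, h1, mul_zero, add_zero]

end Vahlen

/-! ### The map on the conformal space -/

section Gamma

variable {V : Type*} [AddCommGroup V] [Module ℝ V] [FiniteDimensional ℝ V] {Q : QuadraticForm ℝ V}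

theorem exists_column_eq (X : preConformal Q) : ∃ A : vahlenGroup Q, column A = X := by
  obtain ⟨_, A, rfl⟩ := X
  exact ⟨A, rfl⟩

theorem ConformalSpace.exists_mk_column_eq (X : ConformalSpace Q) :
    ∃ A : vahlenGroup Q, ConformalSpace.mk (column A) = X := by
  induction X using Quotient.ind with
  | _ X =>
    obtain ⟨A, rfl⟩ := exists_column_eq X
    exact ⟨A, rfl⟩

theorem ConformalSpace.smul_mk_column (A B : vahlenGroup Q) :
    A • ConformalSpace.mk (column B) = ConformalSpace.mk (column (A * B)) :=
  congrArg ConformalSpace.mk (Subtype.ext (mul_assoc (mat A) (mat B) (idem Q)).symm)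

/-- The map `γ : W → N(V)`, `[A e] ↦ [σ_A n_∞]`. -/
noncomputable def conformalGamma (X : ConformalSpace Q) : nullQuadric (Qhat Q) :=
  nullPoint X.exists_mk_column_eq.choose

/-- This is the independence of the chosen representative. -/
theorem conformalGamma_mk_column (hQ : ∀ v, (∀ w, QuadraticMap.polar Q v w = 0) → v = 0)
    (A : vahlenGroup Q) : conformalGamma (ConformalSpace.mk (column A)) = nullPoint A :=
  nullPoint_eq_of_equiv hQ _ _ (Quotient.exact
    (ConformalSpace.mk (column A)).exists_mk_column_eq.choose_spec)

end Gamma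

end VahlenConformal

open VahlenConformal

theorem mainTheorem5 {V : Type*} [AddCommGroup V] [Module ℝ V] [FiniteDimensional ℝ V]
    (Q : QuadraticForm ℝ V) (hQ : (QuadraticMap.associated (R := ℝ) Q).Nondegenerate) :
    ∃ γ : ConformalSpace Q → nullQuadric (Qhat Q),
      (∀ A : vahlenGroup Q, ∃ (ξ : V × ℝ × ℝ) (hξ : ξ ≠ 0),
        preGamma (column A) = mat A * nInf Q * matRev (mat A) ∧
        mat A * nInf Q * matRev (mat A) = j Q ξ ∧
        (γ (ConformalSpace.mk (column A)) : ℙ ℝ (V × ℝ × ℝ)) = Projectivization.mk ℝ ξ hξ) ∧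
      Function.Bijective γ ∧
      ∀ (A : vahlenGroup Q) (X : ConformalSpace Q), γ (A • X) = psi (vahlenSigma A) (γ X) := by
  replace hQ := polar_eq_zero_of_associated_nondegenerate hQ
  refine ⟨conformalGamma, fun A => ?_, ⟨fun X Y h => ?_, fun p => ?_⟩, fun A X => ?_⟩
  · obtain ⟨c, hc, h⟩ := exists_mat_mul_nInf_mul_matRev hQ A
    refine ⟨_, smul_ne_zero hc (vahlenSigma_ne_zero A nInfVec_ne_zero), preGamma_column A, h, ?_⟩
    rw [conformalGamma_mk_column hQ, nullPoint, Projectivization.mk_eq_mk_iff']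
    -- Here `c` is the ratio of `A n_∞ Ã` to `σ_A n_∞`; it disappears in projective space.
    exact ⟨c⁻¹, by rw [smul_smul, inv_mul_cancel₀ hc, one_smul]⟩
  · obtain ⟨A, rfl⟩ := X.exists_mk_column_eq
    obtain ⟨B, rfl⟩ := Y.exists_mk_column_eq
    rw [conformalGamma_mk_column hQ, conformalGamma_mk_column hQ] at h
    exact Quotient.sound (equiv_of_nullPoint_eq A B h)
  · obtain ⟨A, rfl⟩ := nullPoint_surjective hQ p
    exact ⟨_, conformalGamma_mk_column hQ A⟩
  · obtain ⟨B, rfl⟩ := X.exists_mk_column_eq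
    rw [ConformalSpace.smul_mk_column, conformalGamma_mk_column hQ, conformalGamma_mk_column hQ,
      nullPoint_mul]
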